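/- A \emph{kissing configuration} in $\mathbb{R}^n$ is a set of unit spheres, each externally tangent to the unit sphere $S^{n-1}$ centred at the origin, whose interiors are pairwise disjoint. The \emph{kissing number} $\kappa(n)$ is the maximal size of a kissing configuration in $\mathbb{R}^n$. Then \[ \kappa(25)\ge 197048,\quad \kappa(26)\ge 198512,\quad \kappa(27)\ge 199976,\quad \kappa(28)\ge 204368, \] \[ \kappa(29)\ge 208272,\quad \kappa(30)\ge 219984,\quad \kappa(31)\ge 232874 . \] -/

import Mathlib

/-- A kissing configuration in `ℝⁿ`: a set of unit spheres, each externally tangent to the unit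
sphere centred at the origin, no two of which overlap (the open balls that they bound are
disjoint). -/
structure IsKissingConfiguration (n : ℕ)
    (X : Set (EuclideanGeometry.Sphere (EuclideanSpace ℝ (Fin n)))) : Prop where
  radius_eq_one : ∀ s ∈ X, s.radius = 1
  isExtTangent : ∀ s ∈ X, s.IsExtTangent ⟨0, 1⟩
  nonoverlapping : X.Pairwise fun s t =>
    Disjoint (Metric.ball s.center s.radius) (Metric.ball t.center t.radius)

/-- The kissing number in `ℝⁿ`: the largest size of a kissing configuration in `ℝⁿ`. It is taken
in `ℕ∞`, where every set of sizes has a supremum, so that no default value can occur. -/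
noncomputable def kissingNumber (n : ℕ) : ℕ∞ :=
  sSup {k : ℕ∞ | ∃ X : Set (EuclideanGeometry.Sphere (EuclideanSpace ℝ (Fin n))),
    IsKissingConfiguration n X ∧ X.encard = k}

/-!
Rescaled to the unit sphere, the `196560` minimal vectors of the Leech lattice have pairwise inner
products at most `1 / 2`. Suppose that some of them form disjoint layers, inside each of which the
inner products are even at most `1 / 4`, and that unit vectors of another space `F` are partitioned
into classes, with inner products at most `-1 / 2` inside a class and at most `1 / 2` in general.
Assign distinct classes to the layers and replace each `v` in a layer by the vectors
`(√(2/3) v, √(1/3) u)`, where `u` runs through the class of that layer. The inner product of two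
lifted vectors, `2/3 ⟪v, v'⟫ + 1/3 ⟪u, u'⟫`, is at most `2/3 · 1 - 1/3 · 1/2` for the same `v`,
at most `2/3 · 1/4 + 1/3 · 1` in the same layer, and at most `2/3 · 1/2 + 1/3 · 1/2` in distinct
layers: it never exceeds `1 / 2`.

Turyn's construction of the Golay code yields `64` such layers of `512 = 16 · 32` vectors of shape
`(∓3, ±1²³)`: each of `16` positions carries the entries `∓3` of `32` vectors, whose signs form a
coset of a subcode with minimal distance `12`, and the layers are translates of one another by words
of the Golay code. For `F` of dimension `1` the class is an antipodal pair; in the dimensions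
`2, …, 7` the classes are triangles of roots of `A₂`, `D₃`, `D₄`, `D₅`, `E₆` and `E₇`, each of which
contributes `2 · 512` additional vectors.
-/

open Finset Function
open Module (finrank)
open scoped Matrix RealInnerProductSpace

section SphericalCodes

variable {E F : Type*} [NormedAddCommGroup E] [InnerProductSpace ℝ E]
  [NormedAddCommGroup F] [InnerProductSpace ℝ F] {ι κ Λ : Type*}

/-- A spherical code, as an indexed family: unit vectors, any two of which (at different indices)
have inner product at most `s`. -/
structure IsSphericalCode (s : ℝ) (v : ι → E) : Prop where
  norm_eq_one : ∀ i, ‖v i‖ = 1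
  inner_le : Pairwise fun i j => ⟪v i, v j⟫ ≤ s

theorem IsSphericalCode.one_le_dist {v : ι → E} (hv : IsSphericalCode (1 / 2) v) {i j : ι}
    (hij : i ≠ j) : 1 ≤ dist (v i) (v j) := by
  have hsq : ‖v i - v j‖ ^ 2 = 2 - 2 * ⟪v i, v j⟫ := by
    rw [norm_sub_sq_real, hv.norm_eq_one, hv.norm_eq_one]
    ring
  have hinner := hv.inner_le hij
  rw [dist_eq_norm, ← one_le_sq_iff₀ (norm_nonneg _), hsq]
  linarith

theorem IsSphericalCode.card_le_kissingNumber [FiniteDimensional ℝ E] [Fintype ι] {v : ι → E}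
    (hv : IsSphericalCode (1 / 2) v) :
    (Fintype.card ι : ℕ∞) ≤ kissingNumber (finrank ℝ E) := by
  let e := (stdOrthonormalBasis ℝ E).repr
  let S (i : ι) : EuclideanGeometry.Sphere (EuclideanSpace ℝ (Fin (finrank ℝ E))) :=
    ⟨(2 : ℝ) • e (v i), 1⟩
  have hdist {i j : ι} (hij : i ≠ j) : 2 ≤ dist (S i).center (S j).center := by
    have h : dist (S i).center (S j).center = 2 * dist (v i) (v j) := by
      simp only [S, dist_smul₀, e.dist_map, Real.norm_ofNat]
    linarith [hv.one_le_dist hij]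
  have hS : S.Injective := fun i j hij => by
    by_contra hne
    have := hdist hne
    rw [hij, dist_self] at this
    norm_num at this
  refine le_sSup ⟨Set.range S, ⟨?_, ?_, ?_⟩, ?_⟩
  · rintro _ ⟨i, rfl⟩
    rfl
  · rintro _ ⟨i, rfl⟩
    rw [EuclideanGeometry.Sphere.isExtTangent_iff_dist_center]
    refine ⟨?_, zero_le_one, zero_le_one⟩
    simp only [S, dist_zero_right, norm_smul, e.norm_map, hv.norm_eq_one, Real.norm_ofNat]
    norm_num
  · rintro _ ⟨i, rfl⟩ _ ⟨j, rfl⟩ hne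
    refine Metric.ball_disjoint_ball ?_
    have := hdist (ne_of_apply_ne S hne)
    simp only [S] at this ⊢
    linarith
  · rw [← Set.image_univ, hS.encard_image, Set.encard_univ, ENat.card_eq_coe_fintype_card]

/-- A `60°` spherical code partitioned into classes `u i`, each of which is even a `120°` code. -/
structure IsPartitionedCode (u : Λ → κ → F) : Prop where
  norm_eq_one : ∀ i a, ‖u i a‖ = 1
  inner_le : ∀ i j, i ≠ j → ∀ a b, ⟪u i a, u j b⟫ ≤ 1 / 2
  inner_class_le : ∀ i a b, a ≠ b → ⟪u i a, u i b⟫ ≤ -(1 / 2)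

/-- The code obtained from `v` by replacing, for every `l`, each of the vectors of the layer `S l`
by copies of it lifted in the directions `u l a`. -/
noncomputable def layeredCode (v : ι → E) (S : Λ → Finset ι) (u : Λ → κ → F) :
    {i // ∀ l, i ∉ S l} ⊕ (Σ l, S l × κ) → WithLp 2 (E × F)
  | .inl i => WithLp.toLp 2 (v i, 0)
  | .inr ⟨l, i, a⟩ => WithLp.toLp 2 (√(2 / 3) • v i, √(1 / 3) • u l a)

variable {v : ι → E} {S : Λ → Finset ι} {u : Λ → κ → F}

theorem inner_layeredCode_inl_inl (i j : {i // ∀ l, i ∉ S l}) :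
    ⟪layeredCode v S u (.inl i), layeredCode v S u (.inl j)⟫ = ⟪v i, v j⟫ := by
  simp [layeredCode, WithLp.prod_inner_apply]

theorem inner_layeredCode_inl_inr (i : {i // ∀ l, i ∉ S l}) (q : Σ l, S l × κ) :
    ⟪layeredCode v S u (.inl i), layeredCode v S u (.inr q)⟫ = √(2 / 3) * ⟪v i, v q.2.1⟫ := by
  simp [layeredCode, WithLp.prod_inner_apply, inner_smul_right]

theorem inner_layeredCode_inr_inr (p q : Σ l, S l × κ) :
    ⟪layeredCode v S u (.inr p), layeredCode v S u (.inr q)⟫ =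
      2 / 3 * ⟪v p.2.1, v q.2.1⟫ + 1 / 3 * ⟪u p.1 p.2.2, u q.1 q.2.2⟫ := by
  have hc {c : ℝ} (hc : 0 ≤ c) (x : ℝ) : √c * (√c * x) = c * x := by
    rw [← mul_assoc, Real.mul_self_sqrt hc]
  simp only [layeredCode, WithLp.prod_inner_apply, inner_smul_left, inner_smul_right,
    conj_trivial]
  rw [hc (by norm_num), hc (by norm_num)]

theorem sqrt_mul_le_half {x : ℝ} (hx : x ≤ 1 / 2) : √(2 / 3) * x ≤ 1 / 2 := by
  have h₁ : √(2 / 3) ≤ 1 := Real.sqrt_le_one.2 (by norm_num)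
  nlinarith [Real.sqrt_nonneg (2 / 3)]

theorem inner_layeredCode_inr_inr_le (hv : IsSphericalCode (1 / 2) v)
    (hSv : ∀ l, (S l : Set ι).Pairwise fun i j => ⟪v i, v j⟫ ≤ 1 / 4)
    (hdisj : Pairwise (Disjoint on S)) (hu : IsPartitionedCode u) {p q : Σ l, S l × κ}
    (hpq : p ≠ q) : ⟪layeredCode v S u (.inr p), layeredCode v S u (.inr q)⟫ ≤ 1 / 2 := by
  rw [inner_layeredCode_inr_inr]
  obtain ⟨l, i, a⟩ := p
  obtain ⟨m, j, b⟩ := q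
  dsimp only
  have hvi : ⟪v i, v i⟫ = 1 := by rw [real_inner_self_eq_norm_sq, hv.norm_eq_one, one_pow]
  by_cases hlm : l = m
  · subst hlm
    by_cases hij : i = j
    · subst hij
      have hab : a ≠ b := fun h => hpq (h ▸ rfl)
      linarith [hu.inner_class_le l a b hab]
    · have hvij := hSv l i.2 j.2 (Subtype.coe_injective.ne hij)
      have huab : ⟪u l a, u l b⟫ ≤ 1 := by
        simpa only [hu.norm_eq_one, mul_one] using real_inner_le_norm (u l a) (u l b)
      linarith
  · have hij : (i : ι) ≠ j := fun h => disjoint_left.1 (hdisj hlm) i.2 (h ▸ j.2)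
    linarith [hv.inner_le hij, hu.inner_le l m hlm a b]

theorem isSphericalCode_layeredCode (hv : IsSphericalCode (1 / 2) v)
    (hSv : ∀ l, (S l : Set ι).Pairwise fun i j => ⟪v i, v j⟫ ≤ 1 / 4)
    (hdisj : Pairwise (Disjoint on S)) (hu : IsPartitionedCode u) :
    IsSphericalCode (1 / 2) (layeredCode v S u) where
  norm_eq_one p := by
    rw [← sq_eq_sq₀ (norm_nonneg _) zero_le_one, ← real_inner_self_eq_norm_sq]
    rcases p with i | p
    · rw [inner_layeredCode_inl_inl, real_inner_self_eq_norm_sq, hv.norm_eq_one]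
    · rw [inner_layeredCode_inr_inr, real_inner_self_eq_norm_sq, real_inner_self_eq_norm_sq,
        hv.norm_eq_one, hu.norm_eq_one]
      norm_num
  inner_le := by
    have mixed (i : {i // ∀ l, i ∉ S l}) (p : Σ l, S l × κ) :
        ⟪layeredCode v S u (.inl i), layeredCode v S u (.inr p)⟫ ≤ 1 / 2 := by
      rw [inner_layeredCode_inl_inr]
      exact sqrt_mul_le_half (hv.inner_le fun h => i.2 p.1 (h ▸ p.2.1.2))
    rintro (i | p) (j | q) hne
    · rw [inner_layeredCode_inl_inl]
      exact hv.inner_le fun h => hne (congrArg Sum.inl (Subtype.ext h))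
    · exact mixed i q
    · rw [real_inner_comm]
      exact mixed j p
    · exact inner_layeredCode_inr_inr_le hv hSv hdisj hu fun h => hne (h ▸ rfl)

variable [Fintype ι] [Fintype κ] [Fintype Λ]

theorem card_layeredCode [DecidableEq ι] {s : ℕ} (hdisj : Pairwise (Disjoint on S))
    (hs : ∀ l, #(S l) = s) :
    Fintype.card ({i // ∀ l, i ∉ S l} ⊕ (Σ l, S l × κ)) + Fintype.card Λ * s =
      Fintype.card ι + Fintype.card Λ * s * Fintype.card κ := by
  have hremoved : #(univ.biUnion S) = Fintype.card Λ * s := by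
    rw [card_biUnion fun l _ m _ hlm => hdisj hlm, sum_congr rfl fun l _ => hs l, sum_const,
      card_univ, smul_eq_mul]
  have hkept : Fintype.card {i // ∀ l, i ∉ S l} + Fintype.card Λ * s = Fintype.card ι := by
    rw [← hremoved, Fintype.card_subtype, ← card_compl_add_card (univ.biUnion S)]
    congr 2
    ext i
    simp
  have hlifted : Fintype.card (Σ l, S l × κ) = Fintype.card Λ * s * Fintype.card κ := by
    simp [hs, mul_assoc]
  rw [Fintype.card_sum, hlifted]
  omega

theorem card_add_le_kissingNumber_of_layers [FiniteDimensional ℝ E] [FiniteDimensional ℝ F]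
    [Nonempty κ] {s : ℕ}
    (hv : IsSphericalCode (1 / 2) v)
    (hSv : ∀ l, (S l : Set ι).Pairwise fun i j => ⟪v i, v j⟫ ≤ 1 / 4)
    (hdisj : Pairwise (Disjoint on S)) (hs : ∀ l, #(S l) = s) (hu : IsPartitionedCode u) :
    ((Fintype.card ι + Fintype.card Λ * s * (Fintype.card κ - 1) : ℕ) : ℕ∞) ≤
      kissingNumber (finrank ℝ E + finrank ℝ F) := by
  classical
  have hfin : finrank ℝ (WithLp 2 (E × F)) = finrank ℝ E + finrank ℝ F :=
    (WithLp.linearEquiv 2 ℝ (E × F)).finrank_eq.trans Module.finrank_prod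
  have hcard : Fintype.card ({i // ∀ l, i ∉ S l} ⊕ (Σ l, S l × κ)) =
      Fintype.card ι + Fintype.card Λ * s * (Fintype.card κ - 1) := by
    have h := card_layeredCode (κ := κ) hdisj hs
    have hκ : 1 ≤ Fintype.card κ := Fintype.card_pos
    have hle : Fintype.card Λ * s ≤ Fintype.card Λ * s * Fintype.card κ :=
      Nat.le_mul_of_pos_right _ hκ
    rw [Nat.mul_sub_one]
    omega
  rw [← hfin, ← hcard]
  exact (isSphericalCode_layeredCode hv hSv hdisj hu).card_le_kissingNumber

end SphericalCodes

section IntegralVectors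

variable {κ Λ ι : Type*} [Fintype κ]

/-- The diagonal integral form `∑ c k * x k * y k`. -/
def diagForm (c : κ → ℕ) (x y : κ → ℤ) : ℤ := ∑ k, c k * (x k * y k)

/-- The vector of the Euclidean space that corresponds to `x` when the form `diagForm c` is divided
by `N`; a unit vector if `diagForm c x x = N`. -/
noncomputable def rescale (c : κ → ℕ) (N : ℕ) (x : κ → ℤ) : EuclideanSpace ℝ κ :=
  WithLp.toLp 2 fun k => √(c k / N) * x k

theorem inner_rescale (c : κ → ℕ) (N : ℕ) (x y : κ → ℤ) :
    ⟪rescale c N x, rescale c N y⟫ = diagForm c x y / N := by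
  simp only [PiLp.inner_apply, rescale, diagForm, RCLike.inner_apply, conj_trivial,
    Int.cast_sum, sum_div]
  refine sum_congr rfl fun k _ => ?_
  rw [mul_mul_mul_comm, Real.mul_self_sqrt (by positivity)]
  push_cast
  ring

variable {c : κ → ℕ} {N : ℕ}

theorem norm_rescale (hN : 0 < N) {x : κ → ℤ} (hx : diagForm c x x = N) :
    ‖rescale c N x‖ = 1 := by
  have hN' : (N : ℝ) ≠ 0 := by positivity
  rw [← sq_eq_sq₀ (norm_nonneg _) zero_le_one, ← real_inner_self_eq_norm_sq, inner_rescale, hx,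
    Int.cast_natCast, div_self hN', one_pow]

theorem inner_rescale_le (hN : 0 < N) {x y : κ → ℤ} {p q : ℤ} (hq : 0 < q)
    (h : q * diagForm c x y ≤ p * N) : ⟪rescale c N x, rescale c N y⟫ ≤ p / q := by
  rw [inner_rescale, div_le_div_iff₀ (by positivity) (by positivity), mul_comm]
  exact_mod_cast h

theorem isPartitionedCode_rescale (hN : 0 < N) {u : Λ → ι → κ → ℤ}
    (hnorm : ∀ i a, diagForm c (u i a) (u i a) = N)
    (hinner : ∀ i j, i ≠ j → ∀ a b, 2 * diagForm c (u i a) (u j b) ≤ N)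
    (hclass : ∀ i a b, a ≠ b → 2 * diagForm c (u i a) (u i b) ≤ -N) :
    IsPartitionedCode fun i a => rescale c N (u i a) where
  norm_eq_one i a := norm_rescale hN (hnorm i a)
  inner_le i j hij a b := by
    simpa using inner_rescale_le hN (p := 1) two_pos (by simpa using hinner i j hij a b)
  inner_class_le i a b hab := by
    simpa [neg_div] using
      inner_rescale_le hN (p := -1) two_pos (by simpa using hclass i a b hab)

end IntegralVectors

section BinaryWords

variable {n : ℕ}

/-- The Hamming weight of a binary word, as a recursion which the kernel evaluates quickly. -/
def weight (w : BitVec n) : ℕ := Nat.rec 0 (fun k s => s + w.toNat / 2 ^ k % 2) n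

/-- The coordinates of a binary word, as integers. -/
def bit (w : BitVec n) (k : Fin n) : ℤ := (w.getLsbD k).toNat

/-- The set of coordinates at which a binary word is `1`. -/
def wordSupport (w : BitVec n) : Finset (Fin n) := {k | w.getLsbD k}

theorem mem_wordSupport {w : BitVec n} {k : Fin n} : k ∈ wordSupport w ↔ w.getLsbD k = true := by
  simp [wordSupport]

theorem wordSupport_injective : Injective (wordSupport : BitVec n → Finset (Fin n)) := fun w u h =>
  BitVec.eq_of_getLsbD_eq fun k hk => by
    rw [Bool.eq_iff_iff]
    simpa only [mem_wordSupport] using Finset.ext_iff.1 h ⟨k, hk⟩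

theorem bit_eq_ite (w : BitVec n) (k : Fin n) : bit w k = if k ∈ wordSupport w then 1 else 0 := by
  rw [bit, Bool.toNat, Bool.cond_eq_ite]
  simp only [mem_wordSupport, Nat.cast_ite, Nat.cast_one, Nat.cast_zero]

theorem bit_eq_zero_or_one (w : BitVec n) (k : Fin n) : bit w k = 0 ∨ bit w k = 1 := by
  rw [bit_eq_ite]
  exact (ite_eq_or_eq _ _ _).symm

theorem bit_xor (w u : BitVec n) (k : Fin n) :
    bit (w ^^^ u) k = bit w k + bit u k - 2 * (bit w k * bit u k) := by
  simp only [bit, BitVec.getLsbD_xor]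
  cases w.getLsbD k <;> cases u.getLsbD k <;> rfl

theorem bit_injective : Injective (bit : BitVec n → Fin n → ℤ) := fun w u h =>
  wordSupport_injective <| Finset.ext fun k => by
    have hk := congrFun h k
    simp only [bit_eq_ite] at hk
    split_ifs at hk <;> simp_all

theorem bit_zero (k : Fin n) : bit 0 k = 0 := by simp [bit]

theorem bit_allOnes (k : Fin n) : bit (BitVec.allOnes n) k = 1 := by simp [bit]

theorem sum_bit (w : BitVec n) : ∑ k, bit w k = weight w := by
  have h (m : ℕ) : Nat.rec 0 (fun k s => s + w.toNat / 2 ^ k % 2) m =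
      ∑ k ∈ range m, w.toNat / 2 ^ k % 2 := by
    induction m with
    | zero => rfl
    | succ m ih => rw [sum_range_succ, ← ih]
  rw [weight, h, ← Fin.sum_univ_eq_sum_range, Nat.cast_sum]
  exact sum_congr rfl fun k _ => by rw [bit, BitVec.getLsbD, Nat.toNat_testBit]

theorem weight_zero : weight (0 : BitVec n) = 0 := by
  have h := sum_bit (0 : BitVec n)
  simp only [bit_zero, sum_const_zero] at h
  exact_mod_cast h.symm

theorem card_wordSupport (w : BitVec n) : #(wordSupport w) = weight w := by
  have h := sum_bit w
  simp only [bit_eq_ite, sum_ite_mem, univ_inter, sum_const, nsmul_one] at h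
  exact_mod_cast h

/-- The signs `(-1) ^ w k` given by a binary word. -/
def wordSign (w : BitVec n) (k : Fin n) : ℤ := 1 - 2 * bit w k

theorem wordSign_xor (w u : BitVec n) (k : Fin n) :
    wordSign (w ^^^ u) k = wordSign w k * wordSign u k := by
  simp only [wordSign, bit_xor]
  ring

theorem wordSign_zero (k : Fin n) : wordSign 0 k = 1 := by
  rw [wordSign, bit_zero, mul_zero, sub_zero]

theorem sum_wordSign (w : BitVec n) : ∑ k, wordSign w k = n - 2 * weight w := by
  simp [wordSign, ← mul_sum, sum_bit]

end BinaryWords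

section GolayCode

/-- The defining properties of an extended binary Golay code which enter the minimal norm of the
Leech lattice. -/
structure IsGolayCode (C : Finset (BitVec 24)) : Prop where
  allOnes_mem : BitVec.allOnes 24 ∈ C
  xor_mem : ∀ {w u}, w ∈ C → u ∈ C → w ^^^ u ∈ C
  four_dvd_weight : ∀ {w}, w ∈ C → 4 ∣ weight w
  eight_le_weight : ∀ {w}, w ∈ C → w ≠ 0 → 8 ≤ weight w

/-- The sixteen words of the extended Hamming code of length `8`: the cyclic shifts of `1110100` on
`Fin 7`, extended by a zero, the zero word, and their complements. -/
def hammingWord (p : Fin 8 × Bool) : BitVec 8 :=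
  ![0x17, 0x2E, 0x5C, 0x39, 0x72, 0x65, 0x4B, 0x00] p.1 ^^^ BitVec.fill 8 p.2

/-- The extended Hamming code with the cyclic order reversed; it meets that of `hammingWord` in
`0` and `0xFF` only. The index of the zero word is `(7, true)` here, and `(7, false)` there. -/
def reversedHammingWord (p : Fin 8 × Bool) : BitVec 8 :=
  ![0x1D, 0x3A, 0x74, 0x69, 0x53, 0x27, 0x4E, 0xFF] p.1 ^^^ BitVec.fill 8 p.2

/-- The word `(a + x, b + x, a + b + x)` of Turyn's construction. -/
def turyn (a b x : BitVec 8) : BitVec (8 + 8 + 8) :=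
  (a ^^^ b ^^^ x) ++ (b ^^^ x) ++ (a ^^^ x)

/-- Turyn's parametrization of the Golay code. -/
def golayWord (g : (Fin 8 × Bool) × (Fin 8 × Bool) × (Fin 8 × Bool)) : BitVec 24 :=
  turyn (hammingWord g.1) (hammingWord g.2.1) (reversedHammingWord g.2.2)

theorem turyn_xor (a b x a' b' x' : BitVec 8) :
    turyn a b x ^^^ turyn a' b' x' = turyn (a ^^^ a') (b ^^^ b') (x ^^^ x') := by
  simp only [turyn, BitVec.xor_append]
  congr 1
  · congr 1 <;> ac_rfl
  · ac_rfl

theorem bitVec_append_inj {m n : ℕ} {x x' : BitVec m} {y y' : BitVec n} (h : x ++ y = x' ++ y') :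
    x = x' ∧ y = y' :=
  ⟨by simpa only [BitVec.extractLsb'_append_eq_left] using congrArg (BitVec.extractLsb' n m) h,
    by simpa only [BitVec.setWidth_append_eq_right] using congrArg (BitVec.setWidth n) h⟩

theorem turyn_inj {a b x a' b' x' : BitVec 8} (h : turyn a b x = turyn a' b' x') :
    a = a' ∧ b = b' ∧ x = x' := by
  obtain ⟨h, hax⟩ := bitVec_append_inj h
  obtain ⟨habx, hbx⟩ := bitVec_append_inj h
  rw [BitVec.xor_assoc, BitVec.xor_assoc, hbx, BitVec.xor_left_inj] at habx
  rw [habx, BitVec.xor_right_inj] at hax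
  rw [hax, BitVec.xor_left_inj] at hbx
  exact ⟨habx, hbx, hax⟩

theorem hammingWord_injective : Injective hammingWord := by decide +kernel

theorem reversedHammingWord_injective : Injective reversedHammingWord := by decide +kernel

theorem golayWord_injective : Injective golayWord := by
  intro g g' h
  obtain ⟨hp, hq, hr⟩ := turyn_inj h
  exact Prod.ext (hammingWord_injective hp)
    (Prod.ext (hammingWord_injective hq) (reversedHammingWord_injective hr))

/-- The permutation `i ↦ i + 2` of the cyclic shifts, fixing the index `7` of the zero word. -/
def hammingShift : Fin 8 → Fin 8 := ![2, 3, 4, 5, 6, 0, 1, 7]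

theorem exists_hammingWord_xor (i j : Fin 8) :
    ∃ k, ∀ a b, hammingWord (i, a) ^^^ hammingWord (j, b) = hammingWord (k, a ^^ b) ∧
      hammingWord (hammingShift i, a) ^^^ hammingWord (hammingShift j, b) =
        hammingWord (hammingShift k, a ^^ b) := by
  decide +revert +kernel

theorem exists_reversedHammingWord_xor (p q : Fin 8 × Bool) :
    ∃ r, reversedHammingWord r = reversedHammingWord p ^^^ reversedHammingWord q := by
  decide +revert +kernel

theorem weight_golayWord (g) :
    golayWord g = 0 ∨ 8 ≤ weight (golayWord g) ∧ 4 ∣ weight (golayWord g) := by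
  have h : ∀ p q r, golayWord (p, q, r) = 0 ∨
      8 ≤ weight (golayWord (p, q, r)) ∧ 4 ∣ weight (golayWord (p, q, r)) := by
    decide +kernel
  exact h g.1 g.2.1 g.2.2

theorem card_golayWord_weight_eq_eight : #{g | weight (golayWord g) = 8} = 759 := by
  decide +kernel

/-- The extended binary Golay code. -/
def golay : Finset (BitVec 24) := univ.map ⟨golayWord, golayWord_injective⟩

theorem golayWord_mem_golay (g) : golayWord g ∈ golay := mem_map_of_mem _ (mem_univ g)

theorem card_golay : #golay = 4096 := by
  simp [golay]

theorem card_golay_weight_eq_eight : #{w ∈ golay | weight w = 8} = 759 := by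
  rw [golay, filter_map, card_map]
  exact card_golayWord_weight_eq_eight

theorem isGolayCode_golay : IsGolayCode golay where
  allOnes_mem := golayWord_mem_golay ((7, false), (7, false), (7, false))
  xor_mem := by
    simp only [golay, mem_map, mem_univ, true_and, Embedding.coeFn_mk]
    rintro _ _ ⟨g, rfl⟩ ⟨g', rfl⟩
    obtain ⟨i, hi⟩ := exists_hammingWord_xor g.1.1 g'.1.1
    obtain ⟨j, hj⟩ := exists_hammingWord_xor g.2.1.1 g'.2.1.1
    obtain ⟨r, hr⟩ := exists_reversedHammingWord_xor g.2.2 g'.2.2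
    refine ⟨((i, g.1.2 ^^ g'.1.2), (j, g.2.1.2 ^^ g'.2.1.2), r), ?_⟩
    simp only [golayWord, turyn_xor, (hi _ _).1, (hj _ _).1, hr]
  four_dvd_weight := by
    simp only [golay, mem_map, mem_univ, true_and, Embedding.coeFn_mk]
    rintro _ ⟨g, rfl⟩
    rcases weight_golayWord g with h | h
    · exact h ▸ dvd_zero 4
    · exact h.2
  eight_le_weight := by
    simp only [golay, mem_map, mem_univ, true_and, Embedding.coeFn_mk]
    rintro _ ⟨g, rfl⟩ h0
    exact ((weight_golayWord g).resolve_left h0).1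

end GolayCode

section LeechLattice

variable {C : Finset (BitVec 24)} {x y : Fin 24 → ℤ} {m n : ℤ}

/-- The vectors of the Leech lattice of a binary code, scaled to have minimal squared norm `32`, all
of whose coordinates are congruent to `m` modulo `2`. -/
def IsLeechCoset (C : Finset (BitVec 24)) (m : ℤ) (x : Fin 24 → ℤ) : Prop :=
  (∃ w ∈ C, ∀ k, 4 ∣ x k - m - 2 * bit w k) ∧ 8 ∣ ∑ k, x k - 4 * m

theorem IsLeechCoset.sub (hC : IsGolayCode C) (hx : IsLeechCoset C m x)
    (hy : IsLeechCoset C n y) : IsLeechCoset C (m - n) (x - y) := by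
  obtain ⟨⟨w, hw, hxw⟩, hxs⟩ := hx
  obtain ⟨⟨u, hu, hyu⟩, hys⟩ := hy
  refine ⟨⟨w ^^^ u, hC.xor_mem hw hu, fun k => ?_⟩, ?_⟩
  · have hxk := hxw k
    have hyk := hyu k
    rw [bit_xor, Pi.sub_apply]
    omega
  · simp only [Pi.sub_apply, sum_sub_distrib]
    omega

theorem IsLeechCoset.of_even_sub (hC : IsGolayCode C) (hx : IsLeechCoset C m x)
    (hmn : Even (m - n)) : IsLeechCoset C n x := by
  obtain ⟨⟨w, hw, hxw⟩, hxs⟩ := hx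
  obtain ⟨r, hr⟩ := hmn
  refine ⟨?_, by omega⟩
  rcases Int.even_or_odd' r with ⟨q, hq | hq⟩
  · refine ⟨w, hw, fun k => ?_⟩
    have hxk := hxw k
    omega
  · refine ⟨w ^^^ BitVec.allOnes 24, hC.xor_mem hw hC.allOnes_mem, fun k => ?_⟩
    have hxk := hxw k
    rw [bit_xor, bit_allOnes]
    omega

theorem le_normSq_of_four_dvd {κ : Type*} [Fintype κ] {x : κ → ℤ} (hx : ∀ k, 4 ∣ x k)
    (hsum : 8 ∣ ∑ k, x k) (h0 : x ≠ 0) : 32 ≤ x ⬝ᵥ x := by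
  choose z hz using hx
  obtain rfl : x = fun k => 4 * z k := funext hz
  have hnorm : (fun k => 4 * z k) ⬝ᵥ (fun k => 4 * z k) = 16 * z ⬝ᵥ z := by
    simp only [dotProduct, mul_sum]
    exact sum_congr rfl fun k _ => by ring
  have hpos : 0 < z ⬝ᵥ z := by
    have hz : z ≠ 0 := by
      rintro rfl
      exact h0 rfl
    exact (sum_nonneg fun k _ => mul_self_nonneg (z k)).lt_of_ne' (dotProduct_self_eq_zero.not.2 hz)
  have heven : 2 ∣ z ⬝ᵥ z - ∑ k, z k := by
    rw [dotProduct, ← sum_sub_distrib]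
    refine dvd_sum fun k _ => ?_
    simpa only [mul_sub, mul_one] using (Int.even_mul_pred_self (z k)).two_dvd
  rw [← mul_sum] at hsum
  omega

theorem IsLeechCoset.le_normSq_of_zero (hC : IsGolayCode C) (hx : IsLeechCoset C 0 x)
    (h0 : x ≠ 0) : 32 ≤ x ⬝ᵥ x := by
  obtain ⟨⟨w, hw, hxw⟩, hsum⟩ := hx
  by_cases hw0 : w = 0
  · refine le_normSq_of_four_dvd (fun k => ?_) (by omega) h0
    have hxk := hxw k
    rw [hw0, bit_zero] at hxk
    omega
  · have hle : ∑ k, 4 * bit w k ≤ x ⬝ᵥ x := by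
      refine sum_le_sum fun k _ => ?_
      have hxk := hxw k
      rcases bit_eq_zero_or_one w k with h | h
      · rw [h]
        exact mul_self_nonneg _
      · have : x k ≤ -2 ∨ 2 ≤ x k := by omega
        rw [h]
        rcases this with h | h <;> nlinarith
    rw [← mul_sum, sum_bit] at hle
    have := hC.eight_le_weight hw hw0
    omega

theorem le_normSq_of_odd (hx : ∀ k, Odd (x k)) {k : Fin 24} (hk : x k * x k ≠ 1) :
    32 ≤ x ⬝ᵥ x := by
  have hle : ∑ j : Fin 24, (1 + if j = k then 8 else 0) ≤ x ⬝ᵥ x := by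
    refine sum_le_sum fun j _ => ?_
    obtain ⟨r, hr⟩ := hx j
    split_ifs with hjk
    · have h1 : x j ≠ 1 := fun h => hk (by rw [← hjk, h, one_mul])
      have h2 : x j ≠ -1 := fun h => hk (by rw [← hjk, h]; norm_num)
      have : x j ≤ -3 ∨ 3 ≤ x j := by omega
      rcases this with h | h <;> nlinarith
    · have : 0 < x j * x j := mul_self_pos.2 (by omega)
      omega
  simpa [sum_add_distrib] using hle

theorem IsLeechCoset.le_normSq_of_one (hC : IsGolayCode C) (hx : IsLeechCoset C 1 x) :
    32 ≤ x ⬝ᵥ x := by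
  obtain ⟨⟨w, hw, hxw⟩, hsum⟩ := hx
  by_cases hunit : ∀ k, x k * x k = 1
  · have hsign : ∀ k, x k = wordSign w k := fun k => by
      have hxk := hxw k
      rw [wordSign]
      rcases bit_eq_zero_or_one w k with h | h <;>
      rcases mul_self_eq_one_iff.1 (hunit k) with h' | h' <;> omega
    rw [sum_congr rfl fun k _ => hsign k, sum_wordSign] at hsum
    have := hC.four_dvd_weight hw
    omega
  · push Not at hunit
    obtain ⟨k, hk⟩ := hunit
    refine le_normSq_of_odd (fun j => ?_) hk
    have hxj := hxw j
    rw [Int.odd_iff]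
    omega

theorem IsLeechCoset.le_normSq (hC : IsGolayCode C) (hx : IsLeechCoset C m x) (h0 : x ≠ 0) :
    32 ≤ x ⬝ᵥ x := by
  rcases Int.even_or_odd m with hm | hm
  · exact (hx.of_even_sub hC (n := 0) (by rwa [sub_zero])).le_normSq_of_zero hC h0
  · exact (hx.of_even_sub hC (n := 1) (hm.sub_odd odd_one)).le_normSq_of_one hC

theorem IsLeechCoset.dotProduct_le (hC : IsGolayCode C) (hx : IsLeechCoset C m x)
    (hy : IsLeechCoset C n y) (hx32 : x ⬝ᵥ x = 32) (hy32 : y ⬝ᵥ y = 32) (hxy : x ≠ y) :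
    x ⬝ᵥ y ≤ 16 := by
  have h := (hx.sub hC hy).le_normSq hC (sub_ne_zero.2 hxy)
  rw [sub_dotProduct, dotProduct_sub, dotProduct_sub, dotProduct_comm y x] at h
  omega

end LeechLattice

section MinimalVectors

/-- The vector with entries `-a` on `p.2`, `a` on the rest of `p.1`, and `0` elsewhere. -/
def signedVec {n : ℕ} (a : ℤ) (p : Σ _ : Finset (Fin n), Finset (Fin n)) (k : Fin n) : ℤ :=
  if k ∈ p.2 then -a else if k ∈ p.1 then a else 0

theorem sum_signedVec {n : ℕ} (a : ℤ) {p : Σ _ : Finset (Fin n), Finset (Fin n)} (h : p.2 ⊆ p.1) :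
    ∑ k, signedVec a p k = a * (#p.1 - 2 * #p.2) := by
  have hsplit (k) : signedVec a p k =
      (if k ∈ p.1 then a else 0) - 2 * (if k ∈ p.2 then a else 0) := by
    have := @h k
    simp only [signedVec]
    split_ifs <;> first | ring1 | tauto
  simp only [hsplit, sum_sub_distrib, ← mul_sum, sum_ite_mem, univ_inter, sum_const, nsmul_eq_mul]
  ring

theorem signedVec_dotProduct_self {n : ℕ} (a : ℤ) {p : Σ _ : Finset (Fin n), Finset (Fin n)}
    (h : p.2 ⊆ p.1) : signedVec a p ⬝ᵥ signedVec a p = a * a * #p.1 := by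
  have hsq (k) : signedVec a p k * signedVec a p k = if k ∈ p.1 then a * a else 0 := by
    have := @h k
    simp only [signedVec]
    split_ifs <;> first | ring1 | tauto
  simp only [dotProduct, hsq, sum_ite_mem, univ_inter, sum_const, nsmul_eq_mul]
  ring

theorem signedVec_injOn {n : ℕ} {a : ℤ} (ha : 0 < a) :
    Set.InjOn (signedVec a) {p : Σ _ : Finset (Fin n), Finset (Fin n) | p.2 ⊆ p.1} := by
  rintro ⟨t, s⟩ h ⟨t', s'⟩ h' heq
  have hk (k) : (k ∈ t ↔ k ∈ t') ∧ (k ∈ s ↔ k ∈ s') := by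
    have h1 : k ∈ s → k ∈ t := @h k
    have h2 : k ∈ s' → k ∈ t' := @h' k
    have h3 := congrFun heq k
    simp only [signedVec] at h3
    split_ifs at h3 <;> first | omega | tauto
  obtain rfl : t = t' := Finset.ext fun k => (hk k).1
  obtain rfl : s = s' := Finset.ext fun k => (hk k).2
  rfl

/-- The vector `(∓3, ±1²³)` with signs given by the word `p.1` and the entry `∓3` at `p.2`. -/
def oddVec {n : ℕ} (p : BitVec n × Fin n) (k : Fin n) : ℤ :=
  wordSign p.1 k * (1 - if k = p.2 then 4 else 0)

theorem sum_oddVec {n : ℕ} (p : BitVec n × Fin n) :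
    ∑ k, oddVec p k = n - 2 * weight p.1 - 4 * wordSign p.1 p.2 := by
  simp only [oddVec, mul_sub, mul_one, sum_sub_distrib, sum_wordSign, mul_ite, mul_zero,
    sum_ite_eq', mem_univ, if_true]
  ring

theorem oddVec_dotProduct_oddVec {n : ℕ} (p q : BitVec n × Fin n) :
    oddVec p ⬝ᵥ oddVec q = n - 2 * (weight (p.1 ^^^ q.1) : ℤ) - 4 * wordSign (p.1 ^^^ q.1) p.2 -
      4 * wordSign (p.1 ^^^ q.1) q.2 +
      if p.2 = q.2 then 16 * wordSign (p.1 ^^^ q.1) p.2 else 0 := by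
  have hexpand (k) : oddVec p k * oddVec q k = wordSign (p.1 ^^^ q.1) k -
      4 * (if k = p.2 then wordSign (p.1 ^^^ q.1) p.2 else 0) -
      4 * (if k = q.2 then wordSign (p.1 ^^^ q.1) q.2 else 0) +
      if k = p.2 then if p.2 = q.2 then 16 * wordSign (p.1 ^^^ q.1) p.2 else 0 else 0 := by
    obtain ⟨w, i⟩ := p
    obtain ⟨u, j⟩ := q
    simp only [oddVec]
    rw [mul_mul_mul_comm, ← wordSign_xor]
    split_ifs <;> subst_vars <;> first | ring1 | contradiction
  simp only [dotProduct, hexpand, sum_add_distrib, sum_sub_distrib, ← mul_sum, sum_wordSign,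
    sum_ite_eq', mem_univ, if_true]

theorem oddVec_dotProduct_self {n : ℕ} (p : BitVec n × Fin n) : oddVec p ⬝ᵥ oddVec p = n + 8 := by
  have hxor : p.1 ^^^ p.1 = 0 := BitVec.xor_self
  rw [oddVec_dotProduct_oddVec, hxor, weight_zero, wordSign_zero, if_pos rfl]
  ring

theorem oddVec_injective {n : ℕ} : Injective (oddVec : BitVec n × Fin n → Fin n → ℤ) := by
  rintro ⟨w, i⟩ ⟨u, j⟩ heq
  have hk (k) : bit w k = bit u k ∧ (k = i ↔ k = j) := by
    have h := congrFun heq k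
    simp only [oddVec, wordSign] at h
    rcases bit_eq_zero_or_one w k with h1 | h1 <;> rcases bit_eq_zero_or_one u k with h2 | h2 <;>
    rw [h1, h2] at h ⊢ <;> split_ifs at h <;> simp_all
  exact Prod.ext (bit_injective (funext fun k => (hk k).1)) ((hk i).2.1 rfl)

theorem card_filter_even_powerset {α : Type*} {t : Finset α} (ht : t.Nonempty) :
    2 * #{s ∈ t.powerset | Even #s} = 2 ^ #t := by
  have h := sum_powerset_neg_one_pow_card_of_nonempty ht
  rw [← sum_filter_add_sum_filter_not _ (fun s => Even #s),
    sum_congr rfl (fun s hs => (mem_filter.1 hs).2.neg_one_pow),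
    sum_congr rfl (fun s hs => (Nat.not_even_iff_odd.1 (mem_filter.1 hs).2).neg_one_pow)] at h
  simp only [sum_const, nsmul_eq_mul, mul_one, mul_neg] at h
  have h' := card_filter_add_card_filter_not (s := t.powerset) (fun s => Even #s)
  rw [card_powerset] at h'
  omega

/-- The octads of a binary code: the supports of its words of weight `8`. -/
def octads (C : Finset (BitVec 24)) : Finset (Finset (Fin 24)) :=
  {w ∈ C | weight w = 8}.image wordSupport

/-- The indices of the vectors `(±4², 0ⁿ⁻²)`; irreducible, because unfolding `fourIndex 24` means
enumerating it. -/
@[irreducible] def fourIndex (n : ℕ) : Finset (Σ _ : Finset (Fin n), Finset (Fin n)) :=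
  (powersetCard 2 univ).sigma powerset

/-- The indices of the minimal vectors `(±2⁸, 0¹⁶)`: these are supported on an octad and have an
even number of negative entries. -/
def twoIndex (C : Finset (BitVec 24)) : Finset (Σ _ : Finset (Fin 24), Finset (Fin 24)) :=
  (octads C).sigma fun t => {s ∈ t.powerset | Even #s}

/-- The minimal vectors of the Leech lattice of a binary code. -/
def minimalVec (C : Finset (BitVec 24)) : fourIndex 24 ⊕ twoIndex C ⊕ C × Fin 24 → Fin 24 → ℤ :=
  Sum.elim (fun p => signedVec 4 p)
    (Sum.elim (fun p => signedVec 2 p) fun p => oddVec (p.1, p.2))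

variable {C : Finset (BitVec 24)}

theorem card_octads (C : Finset (BitVec 24)) : #(octads C) = #{w ∈ C | weight w = 8} :=
  card_image_of_injective _ wordSupport_injective

theorem card_of_mem_octads {t : Finset (Fin 24)} (ht : t ∈ octads C) : #t = 8 := by
  obtain ⟨w, hw, rfl⟩ := mem_image.1 ht
  rw [card_wordSupport, (mem_filter.1 hw).2]

theorem nonempty_of_mem_octads {t : Finset (Fin 24)} (ht : t ∈ octads C) : t.Nonempty := by
  rw [← card_pos, card_of_mem_octads ht]
  exact Nat.succ_pos 7

theorem mem_fourIndex {n : ℕ} {p : Σ _ : Finset (Fin n), Finset (Fin n)} :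
    p ∈ fourIndex n ↔ #p.1 = 2 ∧ p.2 ⊆ p.1 := by
  simp only [fourIndex, mem_sigma, mem_powersetCard_univ, mem_powerset]

theorem mem_twoIndex {p : Σ _ : Finset (Fin 24), Finset (Fin 24)} :
    p ∈ twoIndex C ↔ p.1 ∈ octads C ∧ p.2 ⊆ p.1 ∧ Even #p.2 := by
  simp only [twoIndex, mem_sigma, mem_filter, mem_powerset]

theorem card_fourIndex (n : ℕ) : #(fourIndex n) = n.choose 2 * 2 ^ 2 := by
  rw [fourIndex, card_sigma,
    sum_congr rfl fun t ht => by rw [card_powerset, mem_powersetCard_univ.1 ht], sum_const,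
    card_powersetCard, card_univ, Fintype.card_fin, smul_eq_mul]

theorem card_twoIndex (C : Finset (BitVec 24)) : #(twoIndex C) = 128 * #(octads C) := by
  have h (t) (ht : t ∈ octads C) : #{s ∈ t.powerset | Even #s} = 128 := by
    have h2 := card_filter_even_powerset (nonempty_of_mem_octads ht)
    rw [card_of_mem_octads ht] at h2
    omega
  rw [twoIndex, card_sigma, sum_congr rfl h, sum_const, smul_eq_mul, mul_comm]

theorem card_minimalVec_index (C : Finset (BitVec 24)) :
    Fintype.card (fourIndex 24 ⊕ twoIndex C ⊕ C × Fin 24) =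
      Nat.choose 24 2 * 2 ^ 2 + 128 * #{w ∈ C | weight w = 8} + 24 * #C := by
  simp only [Fintype.card_sum, Fintype.card_prod, Fintype.card_coe, Fintype.card_fin,
    card_fourIndex, card_twoIndex, card_octads]
  ring

theorem minimalVec_injective (C : Finset (BitVec 24)) : Injective (minimalVec C) := by
  have hfour (p) (k : Fin 24) : 4 ∣ signedVec 4 p k := by
    simp only [signedVec]
    split_ifs <;> norm_num
  have htwo (p) (k : Fin 24) : 2 ∣ signedVec 2 p k := by
    simp only [signedVec]
    split_ifs <;> norm_num
  have hodd (p) (k : Fin 24) : ¬ 2 ∣ oddVec p k := by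
    simp only [oddVec, wordSign]
    rcases bit_eq_zero_or_one p.1 k with h | h <;> rw [h] <;> split_ifs <;> norm_num
  refine Injective.sumElim ?_ (Injective.sumElim ?_ ?_ fun p q h => ?_) fun p q h => ?_
  · exact fun p q h => Subtype.ext
      (signedVec_injOn four_pos (mem_fourIndex.1 p.2).2 (mem_fourIndex.1 q.2).2 h)
  · exact fun p q h => Subtype.ext
      (signedVec_injOn two_pos (mem_twoIndex.1 p.2).2.1 (mem_twoIndex.1 q.2).2.1 h)
  · intro p q h
    obtain ⟨hw, hi⟩ := Prod.ext_iff.1 (oddVec_injective h)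
    exact Prod.ext (Subtype.ext hw) hi
  · exact hodd _ 0 (h ▸ htwo _ 0)
  · rcases q with q | q
    · obtain ⟨k, hk⟩ := nonempty_of_mem_octads (mem_twoIndex.1 q.2).1
      have h4 := hfour p k
      rw [h] at h4
      simp only [Sum.elim_inl, signedVec, hk, if_true] at h4
      split_ifs at h4 <;> norm_num at h4
    · exact hodd _ 0 (h ▸ (by norm_num : (2 : ℤ) ∣ 4).trans (hfour p 0))

theorem minimalVec_dotProduct_self (p) : minimalVec C p ⬝ᵥ minimalVec C p = 32 := by
  rcases p with p | p | p
  · obtain ⟨hcard, hsub⟩ := mem_fourIndex.1 p.2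
    exact (signedVec_dotProduct_self 4 hsub).trans (by rw [hcard]; rfl)
  · obtain ⟨hoct, hsub, -⟩ := mem_twoIndex.1 p.2
    exact (signedVec_dotProduct_self 2 hsub).trans (by rw [card_of_mem_octads hoct]; rfl)
  · exact oddVec_dotProduct_self _

theorem isLeechCoset_signedVec_four (hC : IsGolayCode C)
    {p : Σ _ : Finset (Fin 24), Finset (Fin 24)} (hp : p ∈ fourIndex 24) :
    IsLeechCoset C 0 (signedVec 4 p) := by
  obtain ⟨hcard, hsub⟩ := mem_fourIndex.1 hp
  have hzero : 0 ∈ C := by simpa using hC.xor_mem hC.allOnes_mem hC.allOnes_mem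
  refine ⟨⟨0, hzero, fun k => ?_⟩, ?_⟩
  · rw [bit_zero, signedVec]
    split_ifs <;> norm_num
  · rw [sum_signedVec 4 hsub, hcard]
    omega

theorem isLeechCoset_signedVec_two {p : Σ _ : Finset (Fin 24), Finset (Fin 24)}
    (hp : p ∈ twoIndex C) : IsLeechCoset C 0 (signedVec 2 p) := by
  obtain ⟨hoct, hsub, heven⟩ := mem_twoIndex.1 hp
  obtain ⟨w, hw, hwp⟩ := mem_image.1 hoct
  refine ⟨⟨w, (mem_filter.1 hw).1, fun k => ?_⟩, ?_⟩
  · have := @hsub k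
    rw [bit_eq_ite, hwp, signedVec]
    split_ifs <;> first | omega | tauto
  · rw [sum_signedVec 2 hsub, card_of_mem_octads hoct]
    obtain ⟨r, hr⟩ := heven
    omega

theorem isLeechCoset_oddVec (hC : IsGolayCode C) {w : BitVec 24} (hw : w ∈ C) (i : Fin 24) :
    IsLeechCoset C 1 (oddVec (w, i)) := by
  refine ⟨⟨w, hw, fun k => ?_⟩, ?_⟩
  · simp only [oddVec, wordSign]
    split_ifs <;> omega
  · have := hC.four_dvd_weight hw
    simp only [sum_oddVec, wordSign]
    omega

theorem exists_isLeechCoset_minimalVec (hC : IsGolayCode C) (p) :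
    ∃ m, IsLeechCoset C m (minimalVec C p) := by
  rcases p with p | p | p
  · exact ⟨0, isLeechCoset_signedVec_four hC p.2⟩
  · exact ⟨0, isLeechCoset_signedVec_two p.2⟩
  · exact ⟨1, isLeechCoset_oddVec hC p.1.2 p.2⟩

theorem diagForm_one {κ : Type*} [Fintype κ] (x y : κ → ℤ) : diagForm 1 x y = x ⬝ᵥ y := by
  simp only [diagForm, dotProduct, Pi.one_apply, Nat.cast_one, one_mul]

theorem isSphericalCode_minimalVec (hC : IsGolayCode C) :
    IsSphericalCode (1 / 2) fun p => rescale 1 32 (minimalVec C p) where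
  norm_eq_one p := norm_rescale (by norm_num) (by
    rw [diagForm_one, minimalVec_dotProduct_self, Nat.cast_ofNat])
  inner_le p q hpq := by
    obtain ⟨m, hm⟩ := exists_isLeechCoset_minimalVec hC p
    obtain ⟨n, hn⟩ := exists_isLeechCoset_minimalVec hC q
    have hle := hm.dotProduct_le hC hn (minimalVec_dotProduct_self p)
      (minimalVec_dotProduct_self q) ((minimalVec_injective C).ne hpq)
    simpa using inner_rescale_le (N := 32) (by norm_num) (p := 1) two_pos
      (by rw [diagForm_one]; norm_num; linarith)

end MinimalVectors

section Layers

/-- The words of a subcode of the Golay code with minimal distance `12`, along whose cosets the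
layers are taken. -/
def layerWord (d : Fin 8 × Bool × Bool) : BitVec 24 :=
  golayWord ((d.1, d.2.1), (hammingShift d.1, d.2.2), (7, true))

/-- The representatives of the sixteen cosets that make up a layer, up to translation. -/
def layerRep (p : Fin 8 × Bool) : BitVec 24 := golayWord ((p.1, false), (7, false), p)

/-- The position of the entries `∓3` of the vectors of a layer in the coset of `layerRep p`. -/
def layerPos (p : Fin 8 × Bool) : Fin 24 :=
  Fin.ofNat 24 (bif p.2 then hammingShift p.1 else 8 + p.1)

/-- The words by which the single layers are translated. -/
def layerTranslation (t : Fin 8 × Fin 8) : BitVec 24 :=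
  golayWord ((7, false), (t.1, false), (t.2, false))

/-- The index of a vector of the layer `t`, as in `oddVec`. -/
def layerIndex (t : Fin 8 × Fin 8) (i : (Fin 8 × Bool) × (Fin 8 × Bool × Bool)) :
    BitVec 24 × Fin 24 :=
  (layerRep i.1 ^^^ layerTranslation t ^^^ layerWord i.2, layerPos i.1)

theorem layerPos_injective : Injective layerPos := by decide +kernel

theorem hammingWord_xor_injective (j : Fin 8) :
    Injective fun p : Fin 8 × Bool => hammingWord (p.1, false) ^^^ hammingWord (j, p.2) := by
  decide +revert +kernel

theorem exists_layerWord_eq_xor (d e : Fin 8 × Bool × Bool) :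
    ∃ c, layerWord c = layerWord d ^^^ layerWord e := by
  obtain ⟨k, hk⟩ := exists_hammingWord_xor d.1 e.1
  refine ⟨(k, d.2.1 ^^ e.2.1, d.2.2 ^^ e.2.2), ?_⟩
  simp only [layerWord, golayWord, turyn_xor, (hk _ _).1, (hk _ _).2]
  congr 1

theorem layerWord_injective : Injective layerWord := by
  intro d e h
  obtain ⟨h₁, h₂, -⟩ := turyn_inj h
  have h₁ := Prod.ext_iff.1 (hammingWord_injective h₁)
  have h₂ := Prod.ext_iff.1 (hammingWord_injective h₂)
  exact Prod.ext h₁.1 (Prod.ext h₁.2 h₂.2)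

theorem twelve_le_weight_layerWord {d : Fin 8 × Bool × Bool} (hd : layerWord d ≠ 0) :
    12 ≤ weight (layerWord d) := by
  have h : ∀ i α β, layerWord (i, α, β) ≠ 0 → 12 ≤ weight (layerWord (i, α, β)) := by
    decide +kernel
  exact h _ _ _ hd

theorem four_add_le_weight_of_ne {p q : Fin 8 × Bool} (hpq : p ≠ q) (d : Fin 8 × Bool × Bool) :
    4 + 4 * (bit (layerRep p ^^^ layerRep q ^^^ layerWord d) (layerPos p) +
      bit (layerRep p ^^^ layerRep q ^^^ layerWord d) (layerPos q)) ≤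
      weight (layerRep p ^^^ layerRep q ^^^ layerWord d) := by
  have h : ∀ i α j β, (i, α) ≠ (j, β) → ∀ k γ δ,
      4 + 4 * (bit (layerRep (i, α) ^^^ layerRep (j, β) ^^^ layerWord (k, γ, δ)) (layerPos (i, α)) +
        bit (layerRep (i, α) ^^^ layerRep (j, β) ^^^ layerWord (k, γ, δ)) (layerPos (j, β))) ≤
        weight (layerRep (i, α) ^^^ layerRep (j, β) ^^^ layerWord (k, γ, δ)) := by
    decide +kernel
  exact h _ _ _ _ hpq _ _ _

theorem exists_layerIndex_xor (t i j) : ∃ d, (layerIndex t i).1 ^^^ (layerIndex t j).1 =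
    layerRep i.1 ^^^ layerRep j.1 ^^^ layerWord d ∧
      layerWord d = layerWord i.2 ^^^ layerWord j.2 := by
  obtain ⟨d, hd⟩ := exists_layerWord_eq_xor i.2 j.2
  refine ⟨d, ?_, hd⟩
  have hcancel (a b c x y : BitVec 24) : a ^^^ c ^^^ x ^^^ (b ^^^ c ^^^ y) =
      a ^^^ b ^^^ (x ^^^ y) ^^^ (c ^^^ c) := by ac_rfl
  simp only [layerIndex, hd, hcancel, BitVec.xor_self, BitVec.xor_zero]

theorem oddVec_layerIndex_dotProduct_le (t) {i j} (hij : i ≠ j) :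
    oddVec (layerIndex t i) ⬝ᵥ oddVec (layerIndex t j) ≤ 8 := by
  obtain ⟨d, hxor, hd⟩ := exists_layerIndex_xor t i j
  rw [oddVec_dotProduct_oddVec, hxor]
  by_cases hp : i.1 = j.1
  · have hd0 : layerWord d ≠ 0 := by
      rw [hd]
      exact BitVec.xor_eq_zero_iff.not.2 (layerWord_injective.ne fun h => hij (Prod.ext hp h))
    have hweight := twelve_le_weight_layerWord hd0
    have hpos : (layerIndex t i).2 = (layerIndex t j).2 := congrArg layerPos hp
    rw [if_pos hpos, hpos, hp, BitVec.xor_self, BitVec.zero_xor]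
    simp only [layerIndex, wordSign]
    rcases bit_eq_zero_or_one (layerWord d) (layerPos j.1) with h | h <;> rw [h] <;> omega
  · have hweight := four_add_le_weight_of_ne hp d
    have hpos : (layerIndex t i).2 ≠ (layerIndex t j).2 := layerPos_injective.ne hp
    rw [if_neg hpos]
    simp only [layerIndex, wordSign]
    omega

theorem layerIndex_injective : Injective fun p : _ × _ => layerIndex p.1 p.2 := by
  rintro ⟨⟨b, c⟩, p, i, α, β⟩ ⟨⟨b', c'⟩, p', i', α', β'⟩ h
  obtain ⟨hword, hpos⟩ := Prod.ext_iff.1 h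
  obtain rfl := layerPos_injective hpos
  simp only [layerIndex, layerRep, layerTranslation, layerWord, golayWord, turyn_xor,
    BitVec.xor_assoc] at hword
  obtain ⟨h₁, h₂, h₃⟩ := turyn_inj hword
  simp only [BitVec.xor_right_inj, BitVec.xor_left_inj] at h₁ h₂ h₃
  obtain ⟨rfl, rfl⟩ := Prod.mk.inj (hammingWord_injective h₁)
  obtain ⟨rfl, rfl⟩ := Prod.mk.inj (hammingWord_xor_injective _ (a₁ := (b, β)) (a₂ := (b', β')) h₂)
  obtain ⟨rfl, -⟩ := Prod.mk.inj (reversedHammingWord_injective h₃)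
  rfl

theorem layerIndex_mem (t i) : (layerIndex t i).1 ∈ golay :=
  isGolayCode_golay.xor_mem (isGolayCode_golay.xor_mem (golayWord_mem_golay _)
    (golayWord_mem_golay _)) (golayWord_mem_golay _)

/-- The index of a vector of the layer `t`, as in `minimalVec golay`. -/
def leechLayerIndex (t : Fin 8 × Fin 8) (i : (Fin 8 × Bool) × (Fin 8 × Bool × Bool)) :
    fourIndex 24 ⊕ twoIndex golay ⊕ golay × Fin 24 :=
  .inr (.inr (⟨(layerIndex t i).1, layerIndex_mem t i⟩, (layerIndex t i).2))

theorem leechLayerIndex_injective : Injective fun p : _ × _ => leechLayerIndex p.1 p.2 := by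
  intro p q h
  obtain ⟨hword, hpos⟩ := Prod.ext_iff.1 (Sum.inr_injective (Sum.inr_injective h))
  exact layerIndex_injective (Prod.ext (congrArg Subtype.val hword) hpos)

/-- The `64` disjoint layers of the Leech lattice: sets of `512` minimal vectors any two of which
have inner product at most `1 / 4` of their squared norm. -/
def leechLayer (t : Fin 8 × Fin 8) : Finset (fourIndex 24 ⊕ twoIndex golay ⊕ golay × Fin 24) :=
  univ.image (leechLayerIndex t)

theorem card_leechLayer (t) : #(leechLayer t) = 512 := by
  have h : Injective (leechLayerIndex t) := fun i j hij =>
    (Prod.ext_iff.1 (leechLayerIndex_injective (a₁ := (t, i)) (a₂ := (t, j)) hij)).2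
  simp [leechLayer, card_image_of_injective _ h]

theorem pairwise_disjoint_leechLayer : Pairwise (Disjoint on leechLayer) := by
  intro s t hst
  refine disjoint_left.2 fun x hs ht => hst ?_
  obtain ⟨i, -, hi⟩ := mem_image.1 hs
  obtain ⟨j, -, hj⟩ := mem_image.1 ht
  exact (Prod.ext_iff.1
    (leechLayerIndex_injective (a₁ := (s, i)) (a₂ := (t, j)) (hi.trans hj.symm))).1

theorem pairwise_inner_leechLayer (t) : (leechLayer t : Set _).Pairwise fun p q =>
    ⟪rescale 1 32 (minimalVec golay p), rescale 1 32 (minimalVec golay q)⟫ ≤ 1 / 4 := by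
  intro p hp q hq hne
  obtain ⟨i, -, rfl⟩ := mem_image.1 (mem_coe.1 hp)
  obtain ⟨j, -, rfl⟩ := mem_image.1 (mem_coe.1 hq)
  have hle : minimalVec golay (leechLayerIndex t i) ⬝ᵥ minimalVec golay (leechLayerIndex t j) ≤ 8 :=
    oddVec_layerIndex_dotProduct_le t (ne_of_apply_ne _ hne)
  have h : 4 * diagForm 1 (minimalVec golay (leechLayerIndex t i))
      (minimalVec golay (leechLayerIndex t j)) ≤ 1 * (32 : ℕ) := by
    rw [diagForm_one]
    push_cast
    linarith
  simpa using inner_rescale_le (by norm_num) four_pos h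

theorem card_minimalVec_golay_index :
    Fintype.card (fourIndex 24 ⊕ twoIndex golay ⊕ golay × Fin 24) = 196560 := by
  rw [card_minimalVec_index, card_golay, card_golay_weight_eq_eight]
  decide

theorem le_kissingNumber_of_isPartitionedCode {F Λ κ : Type*} [NormedAddCommGroup F]
    [InnerProductSpace ℝ F] [FiniteDimensional ℝ F] [Fintype Λ] [Fintype κ] [Nonempty κ]
    {u : Λ → κ → F} (hu : IsPartitionedCode u) (hΛ : Fintype.card Λ ≤ 64) :
    ((196560 + Fintype.card Λ * 512 * (Fintype.card κ - 1) : ℕ) : ℕ∞) ≤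
      kissingNumber (24 + finrank ℝ F) := by
  obtain ⟨e⟩ := Embedding.nonempty_of_card_le (α := Λ) (β := Fin 8 × Fin 8) hΛ
  have h := card_add_le_kissingNumber_of_layers (S := leechLayer ∘ e)
    (isSphericalCode_minimalVec isGolayCode_golay) (fun l => pairwise_inner_leechLayer (e l))
    (fun l m hlm => pairwise_disjoint_leechLayer (e.injective.ne hlm))
    (fun l => card_leechLayer (e l)) hu
  rwa [card_minimalVec_golay_index, finrank_euclideanSpace_fin] at h

end Layers

section SmallCodes

/-- The vertices of an equilateral triangle with centre `0`, given by two of them. -/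
def triangle {κ : Type*} (x y : κ → ℤ) : Fin 3 → κ → ℤ := ![x, y, -x - y]

/-- The minimal vectors of the lattice `ℤ`, as a single antipodal pair. -/
def z1Code : Fin 1 → Fin 2 → Fin 1 → ℤ := ![![![1], ![-1]]]

/-- The roots of `A₂`, for the form `x² + 3y²`. -/
def a2Code : Fin 2 → Fin 3 → Fin 2 → ℤ := ![triangle ![2, 0] ![-1, 1], triangle ![-2, 0] ![1, -1]]

/-- The roots of `D₃`. -/
def d3Code : Fin 4 → Fin 3 → Fin 3 → ℤ := ![
  triangle ![1, -1, 0] ![0, 1, -1], triangle ![1, 1, 0] ![0, -1, 1],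
  triangle ![-1, 1, 0] ![0, -1, -1], triangle ![-1, -1, 0] ![0, 1, 1]]

/-- The roots of `D₄`, as the units of the Hurwitz quaternions scaled by `2`. -/
def d4Code : Fin 8 → Fin 3 → Fin 4 → ℤ := ![
  triangle ![2, 0, 0, 0] ![-1, 1, 1, 1], triangle ![-2, 0, 0, 0] ![1, -1, -1, -1],
  triangle ![0, 2, 0, 0] ![-1, -1, 1, -1], triangle ![0, -2, 0, 0] ![1, 1, -1, 1],
  triangle ![0, 0, 2, 0] ![-1, -1, -1, 1], triangle ![0, 0, -2, 0] ![1, 1, 1, -1],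
  triangle ![0, 0, 0, 2] ![-1, 1, -1, -1], triangle ![0, 0, 0, -2] ![1, -1, 1, 1]]

/-- Thirty-six of the forty roots of `D₅`. -/
def d5Code : Fin 12 → Fin 3 → Fin 5 → ℤ := ![
  triangle ![0, 0, 1, 1, 0] ![0, 0, 0, -1, -1], triangle ![1, 0, 0, -1, 0] ![0, -1, 0, 1, 0],
  triangle ![1, 0, 0, 1, 0] ![0, 0, -1, -1, 0], triangle ![0, 1, -1, 0, 0] ![0, 0, 1, 0, 1],
  triangle ![1, 0, 0, 0, -1] ![0, 0, 0, -1, 1], triangle ![0, 1, 0, 0, 1] ![0, 0, 1, 0, -1],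
  triangle ![0, 0, 1, -1, 0] ![0, 0, 0, 1, 1], triangle ![1, -1, 0, 0, 0] ![0, 1, 0, 0, -1],
  triangle ![1, 0, -1, 0, 0] ![0, 1, 1, 0, 0], triangle ![1, 0, 0, 0, 1] ![0, 0, 0, 1, -1],
  triangle ![0, 1, 0, -1, 0] ![0, 0, -1, 1, 0], triangle ![1, 1, 0, 0, 0] ![0, -1, 0, 0, 1]]

/-- The Eisenstein integers `ω ^ a`, in the coordinates `(x, y) ↦ (x + √-3 y) / 2`. -/
def eisensteinUnit : Fin 3 → Fin 2 → ℤ := ![![2, 0], ![-1, 1], ![-1, -1]]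

/-- The Eisenstein integers `√-3 ω ^ a`, in the coordinates of `eisensteinUnit`. -/
def eisensteinTheta : Fin 3 → Fin 2 → ℤ := ![![0, 2], ![-3, -1], ![3, -1]]

/-- The roots of `E₆`, as the vectors `± ω ^ a (√-3, 0, 0)`, up to the order of the coordinates, and
`± ω ^ a (1, ω ^ b, ω ^ c)` over the Eisenstein integers. -/
def e6Code : ℤˣ × (Fin 3 ⊕ Fin 3 × Fin 3) → Fin 3 → Fin 3 × Fin 2 → ℤ
  | (ε, .inl j), a, (k, l) => if k = j then ε * eisensteinTheta a l else 0
  | (ε, .inr (b, c)), a, (k, l) => ε * eisensteinUnit (a + ![0, b, c] k) l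

/-- Representatives of the orbits of the triangles in `e7Code` under cyclic shifts. -/
def e7Triangle : Fin 6 → Fin 3 → Fin 7 → ℤ := ![
  triangle ![2, 0, 0, 0, 0, 0, 0] ![-1, 1, 1, 0, 1, 0, 0],
  triangle ![-2, 0, 0, 0, 0, 0, 0] ![1, 1, 1, 0, 1, 0, 0],
  triangle ![0, 1, 0, 0, 1, 1, -1] ![0, 0, -1, -1, -1, 0, 1],
  triangle ![0, 0, 1, -1, 1, 0, 1] ![0, -1, -1, 1, 0, -1, 0],
  triangle ![0, 1, 1, 1, 0, -1, 0] ![0, -1, 0, 0, -1, 1, -1],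
  triangle ![0, 1, -1, 1, 0, -1, 0] ![0, 0, 1, -1, -1, 0, 1]]

/-- The roots of `E₇`: the vectors `±2 e_k` and the vectors with entries `±1` on the words of weight
`4` of a cyclic Hamming code. -/
def e7Code (i : Fin 7 × Fin 6) (a : Fin 3) (k : Fin 7) : ℤ := e7Triangle i.2 a (k - i.1)

theorem isPartitionedCode_z1 : IsPartitionedCode fun i a => rescale 1 1 (z1Code i a) :=
  isPartitionedCode_rescale one_pos (by decide) (by decide) (by decide)

theorem isPartitionedCode_a2 : IsPartitionedCode fun i a => rescale ![1, 3] 4 (a2Code i a) :=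
  isPartitionedCode_rescale four_pos (by decide +kernel) (by decide +kernel) (by decide +kernel)

theorem isPartitionedCode_d3 : IsPartitionedCode fun i a => rescale 1 2 (d3Code i a) :=
  isPartitionedCode_rescale two_pos (by decide +kernel) (by decide +kernel) (by decide +kernel)

theorem isPartitionedCode_d4 : IsPartitionedCode fun i a => rescale 1 4 (d4Code i a) :=
  isPartitionedCode_rescale four_pos (by decide +kernel) (by decide +kernel) (by decide +kernel)

theorem isPartitionedCode_d5 : IsPartitionedCode fun i a => rescale 1 2 (d5Code i a) :=
  isPartitionedCode_rescale two_pos (by decide +kernel) (by decide +kernel) (by decide +kernel)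

theorem isPartitionedCode_e6 :
    IsPartitionedCode fun i a => rescale (fun k => ![1, 3] k.2) 12 (e6Code i a) :=
  isPartitionedCode_rescale (by norm_num) (by decide +kernel) (by decide +kernel)
    (by decide +kernel)

theorem diagForm_one_translate {G : Type*} [AddCommGroup G] [Fintype G] (x y : G → ℤ) (r s : G) :
    diagForm 1 (fun k => x (k - r)) (fun k => y (k - s)) =
      diagForm 1 x (fun k => y (k - (s - r))) :=
  Fintype.sum_equiv (Equiv.subRight r) _ _ fun k => by
    simp only [Equiv.subRight_apply, Pi.one_apply, sub_sub_sub_cancel_right]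

theorem diagForm_e7Code (r s : Fin 7) (i j : Fin 6) (a b : Fin 3) :
    diagForm 1 (e7Code (r, i) a) (e7Code (s, j) b) =
      diagForm 1 (e7Triangle i a) (e7Code (s - r, j) b) :=
  diagForm_one_translate _ _ _ _

theorem isPartitionedCode_e7 : IsPartitionedCode fun i a => rescale 1 4 (e7Code i a) := by
  have hnorm : ∀ i a, diagForm 1 (e7Triangle i a) (e7Code (0, i) a) = 4 := by decide +kernel
  have hinner : ∀ i s j, s ≠ 0 ∨ i ≠ j → ∀ a b,
      2 * diagForm 1 (e7Triangle i a) (e7Code (s, j) b) ≤ 4 := by decide +kernel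
  have hclass : ∀ i a b, a ≠ b → 2 * diagForm 1 (e7Triangle i a) (e7Code (0, i) b) ≤ -4 := by
    decide +kernel
  refine isPartitionedCode_rescale four_pos ?_ ?_ ?_
  · rintro ⟨r, i⟩ a
    rw [diagForm_e7Code, sub_self]
    exact hnorm i a
  · rintro ⟨r, i⟩ ⟨s, j⟩ hne a b
    rw [diagForm_e7Code]
    refine hinner i (s - r) j ?_ a b
    by_contra! h
    exact hne (Prod.ext (sub_eq_zero.1 h.1).symm h.2)
  · rintro ⟨r, i⟩ a b hab
    rw [diagForm_e7Code, sub_self]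
    exact hclass i a b hab

end SmallCodes

theorem theorem3p1_general :
    197072 ≤ kissingNumber 25 ∧
    198608 ≤ kissingNumber 26 ∧
    200656 ≤ kissingNumber 27 ∧
    204752 ≤ kissingNumber 28 ∧
    208848 ≤ kissingNumber 29 ∧
    221136 ≤ kissingNumber 30 ∧
    239568 ≤ kissingNumber 31 := by
  refine ⟨?_, ?_, ?_, ?_, ?_, ?_, ?_⟩
  · simpa using le_kissingNumber_of_isPartitionedCode isPartitionedCode_z1 (by decide)
  · simpa using le_kissingNumber_of_isPartitionedCode isPartitionedCode_a2 (by decide)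
  · simpa using le_kissingNumber_of_isPartitionedCode isPartitionedCode_d3 (by decide)
  · simpa using le_kissingNumber_of_isPartitionedCode isPartitionedCode_d4 (by decide)
  · simpa using le_kissingNumber_of_isPartitionedCode isPartitionedCode_d5 (by decide)
  · simpa using le_kissingNumber_of_isPartitionedCode isPartitionedCode_e6 (by decide)
  · simpa using le_kissingNumber_of_isPartitionedCode isPartitionedCode_e7 (by decide)

theorem theorem3p1 :
    197048 ≤ kissingNumber 25 ∧
    198512 ≤ kissingNumber 26 ∧
    199976 ≤ kissingNumber 27 ∧
    204368 ≤ kissingNumber 28 ∧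
    208272 ≤ kissingNumber 29 ∧
    219984 ≤ kissingNumber 30 ∧
    232874 ≤ kissingNumber 31 := by
  obtain ⟨h25, h26, h27, h28, h29, h30, h31⟩ := theorem3p1_general
  exact ⟨h25.trans' (by norm_num), h26.trans' (by norm_num), h27.trans' (by norm_num),
    h28.trans' (by norm_num), h29.trans' (by norm_num), h30.trans' (by norm_num),
    h31.trans' (by norm_num)⟩
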